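/- For a real Banach space $X$, a weak$^*$-compact set $K\subset X^*$ and $\varepsilon>0$, let $s_\varepsilon K$ be the set $K$ minus the union of all relatively weak$^*$-open subsets of $K$ of norm diameter less than $\varepsilon$. Put $s_\varepsilon^0K=K$, $s_\varepsilon^{\alpha+1}K=s_\varepsilon(s_\varepsilon^\alpha K)$, and $s_\varepsilon^\alpha K=\bigcap_{\beta<\alpha}s_\varepsilon^\beta K$ for limit ordinals $\alpha$. Let $Sz(X,\varepsilon)$ be the least ordinal $\alpha$ such that $s_\varepsilon^\alpha B_{X^*}=\emptyset$ ($\infty$ if there is none), where $B_{X^*}$ is the closed unit ball of $X^*$, and let $Sz(X)=\sup_{\varepsilon>0}Sz(X,\varepsilon)$ be the Szlenk index of $X$. A Banach space is said to have a basis if it has a Schauder basis $(e_n)_{n\in\mathbb N}$ or is finite-dimensional with a finite (possibly empty) linear basis. Let $X$ be a reflexive real Banach space and let $\alpha<\omega_1$ be a countable ordinal such that $Sz(X)>\alpha$. Then: (i) there is a closed subspace $Y$ of $X$ with a basis such that $Sz(Y)>\alpha$; (ii) there is a closed subspace $Z$ of $X$ such that $X/Z$ has a basis and $Sz(X/Z)>\alpha$.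 Moreover, if $X$ is infinite-dimensional, then $Y$ in (i) and $X/Z$ in (ii) can be chosen infinite-dimensional, so that their bases are Schauder bases indexed by $\mathbb N$. -/

import Mathlib

open scoped Ordinal

universe u

noncomputable section

/-- A real normed space is reflexive if the canonical embedding into its bidual is onto. -/
def IsReflexiveSpace (X : Type u) [NormedAddCommGroup X] [NormedSpace ℝ X] : Prop :=
  Function.Surjective (NormedSpace.inclusionInDoubleDual ℝ X)

/-- The space has a basis: either a Schauder basis `(e_n)` indexed by `ℕ`, or, for
finite-dimensional spaces, a finite (possibly empty) linear basis. -/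
def HasBasis (X : Type u) [NormedAddCommGroup X] [NormedSpace ℝ X] : Prop :=
  Nonempty (SchauderBasis ℝ X) ∨ ∃ n : ℕ, Nonempty (Module.Basis (Fin n) ℝ X)

section Szlenk

variable {X : Type u} [NormedAddCommGroup X] [NormedSpace ℝ X]

/-- `V` is a relatively weak*-open subset of `K ⊆ X*`. -/
def IsRelWeakStarOpen (K V : Set (StrongDual ℝ X)) : Prop :=
  ∃ U : Set (WeakDual ℝ X), IsOpen U ∧ V = K ∩ StrongDual.toWeakDual ⁻¹' U

/-- The Szlenk derivation `s_ε K`: remove from `K` all relatively weak*-open subsets of `K`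
whose norm diameter is less than `ε`. -/
def szlenkDerivative (ε : ℝ) (K : Set (StrongDual ℝ X)) : Set (StrongDual ℝ X) :=
  K \ ⋃₀ {V | IsRelWeakStarOpen K V ∧ Metric.ediam V < ENNReal.ofReal ε}

/-- The transfinite iterates `s_ε^α K`. -/
def szlenkIter (ε : ℝ) (K : Set (StrongDual ℝ X)) (α : Ordinal.{u}) :
    Set (StrongDual ℝ X) :=
  Ordinal.limitRecOn (motive := fun _ => Set (StrongDual ℝ X)) α K
    (fun _ S => szlenkDerivative ε S)
    (fun α _ S => ⋂ (β : Ordinal.{u}) (h : β < α), S β h)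

theorem szlenkIter_zero (ε : ℝ) (K : Set (StrongDual ℝ X)) : szlenkIter ε K 0 = K :=
  Ordinal.limitRecOn_zero _ _ _

theorem szlenkIter_add_one (ε : ℝ) (K : Set (StrongDual ℝ X)) (α : Ordinal.{u}) :
    szlenkIter ε K (α + 1) = szlenkDerivative ε (szlenkIter ε K α) :=
  Ordinal.limitRecOn_add_one _ _ _ _

theorem szlenkIter_limit (ε : ℝ) (K : Set (StrongDual ℝ X)) {α : Ordinal.{u}}
    (hα : Order.IsSuccLimit α) :
    szlenkIter ε K α = ⋂ (β : Ordinal.{u}) (_ : β < α), szlenkIter ε K β :=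
  Ordinal.limitRecOn_limit _ _ _ _ hα

end Szlenk

section Index

variable (X : Type u) [NormedAddCommGroup X] [NormedSpace ℝ X]

/-- `Sz(X, ε)`: the least ordinal `α` with `s_ε^α B_{X*} = ∅`, and `⊤` (that is, `∞`) if there is
no such ordinal. -/
def szlenkIndexAt (ε : ℝ) : WithTop Ordinal.{u} :=
  sInf ((fun α : Ordinal.{u} => (α : WithTop Ordinal.{u})) ''
    {α | szlenkIter ε (Metric.closedBall (0 : StrongDual ℝ X) 1) α = ∅})

/-- The Szlenk index `Sz(X) = sup_{ε > 0} Sz(X, ε)`. -/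
def szlenkIndex : WithTop Ordinal.{u} :=
  ⨆ (ε : ℝ) (_ : 0 < ε), szlenkIndexAt X ε

end Index

end

/-!
Write `s_ε^β` for the derived sets of the dual ball of `X`, and suppose that `s_ε^α` is nonempty. If
`α = 0` and `X` is finite-dimensional, the zero subspace and the zero quotient do. If `X` is
infinite-dimensional, every weak* neighbourhood of `0` contains functionals of norm one, so
`Sz(X) > 1`, and `α` may be assumed nonzero.

Fix a countable tree whose root is labelled `α` and in which each node labelled `γ` has infinitely
many children of each label `β < γ`; since `α` is countable, the tree can be indexed by `ℕ` with
parents preceding children (`exists_isOrdinalTree`). Functionals `x n ∈ s_ε^{lab n}` are chosen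
inductively: a point of `s_ε^γ` is a weak*-limit of points of `s_ε^β` at distance at least `ε / 4`
from it, so the branch `d m`, the difference between `x (m + 1)` and the value at its parent, can be
bounded below and arbitrarily weak*-small. By Mazur's lemma it is then almost orthogonal to any
prescribed finite-dimensional space of functionals. Applied to the span of finitely many
functionals almost norming a finite-dimensional subspace of `X`, this also produces a vector `y m`
of the unit ball which is almost orthogonal to that subspace and at which `d m` is bounded below
(`exists_branch`). Thus both `d` and `y` become basic sequences, and `d m (y k) → 0` for each `k`
(`IsOrdinalTree.exists_isBasicTree`).

Conversely, a tree of functionals in a dual ball with separated, weak*-null branches keeps the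
derived sets up to order `α` nonempty (`IsOrdinalTree.mem_szlenkIter`).

* Subspace: on the closed span `Y` of `y`, the restrictions of the `x n` form such a tree, as the
  branches stay large at the `y m` and tend to `0` on a set with dense span.
* Quotient: let `Z` be the common kernel of the `d m`. By reflexivity the dual of `X ⧸ Z` is the
  closed span of `d`, and the functionals biorthogonal to `d` are represented by vectors of `X`,
  whose classes form a basis of `X ⧸ Z` (`exists_biorthogonal_quotient`). The functionals
  `(x n - x 0) / 2` vanish on `Z` and form a tree in the dual ball of `X ⧸ Z`, whose branches are
  weak*-null by biorthogonality.
-/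

open Filter Topology

/-! ### Szlenk derivations -/

section SzlenkFacts

variable {X : Type u} [NormedAddCommGroup X] [NormedSpace ℝ X]

theorem szlenkIter_antitone (ε : ℝ) (K : Set (StrongDual ℝ X)) : Antitone (szlenkIter ε K) := by
  intro β γ h
  induction γ using Ordinal.limitRecOn with
  | zero => rw [nonpos_iff_eq_zero.mp h]
  | add_one γ ih =>
    rcases h.eq_or_lt with rfl | h
    · exact le_rfl
    · rw [szlenkIter_add_one]
      exact Set.sdiff_subset.trans (ih (Order.lt_add_one_iff.mp h))
  | limit γ hγ ih =>
    rcases h.eq_or_lt with rfl | h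
    · exact le_rfl
    · rw [szlenkIter_limit ε K hγ]
      exact Set.biInter_subset_of_mem (s := Set.Iio γ) h

/-- The Szlenk index exceeds `α` exactly when, for some `ε`, the derived set of order `α` of the
dual ball is nonempty. -/
theorem lt_szlenkIndex_iff {α : Ordinal.{u}} :
    (α : WithTop Ordinal.{u}) < szlenkIndex X ↔
      ∃ ε : ℝ, 0 < ε ∧ (szlenkIter ε (Metric.closedBall (0 : StrongDual ℝ X) 1) α).Nonempty := by
  unfold szlenkIndex
  simp only [lt_iSup_iff, exists_prop]
  refine exists_congr fun ε => and_congr_right fun _ => ?_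
  unfold szlenkIndexAt
  constructor
  · intro h
    by_contra hne
    exact h.not_ge (sInf_le ⟨α, Set.not_nonempty_iff_eq_empty.mp hne, rfl⟩)
  · rintro ⟨x, hx⟩
    have hlt : (α : WithTop Ordinal.{u}) < ((α + 1 : Ordinal.{u}) : WithTop Ordinal.{u}) :=
      WithTop.coe_lt_coe.mpr (Order.lt_add_one_iff.mpr le_rfl)
    refine hlt.trans_le (le_sInf ?_)
    rintro _ ⟨γ, hγ, rfl⟩
    refine WithTop.coe_le_coe.mpr (Order.add_one_le_of_lt (not_le.mp fun hγα => ?_))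
    have := szlenkIter_antitone ε _ hγα hx
    rw [hγ] at this
    exact this

/-- Every point of a derived set is a weak*-limit of points of the earlier derived sets that stay
at distance at least `ε / 4` from it. -/
theorem exists_mem_szlenkIter_far {ε : ℝ} (hε : 0 < ε) {K : Set (StrongDual ℝ X)}
    {β γ : Ordinal.{u}} (hγ : γ < β) {x : StrongDual ℝ X} (hx : x ∈ szlenkIter ε K β)
    {P : WeakDual ℝ X → Prop} (hP : ∀ᶠ w in 𝓝 0, P w) :
    ∃ z ∈ szlenkIter ε K γ, ε / 4 ≤ ‖z - x‖ ∧ P (StrongDual.toWeakDual (z - x)) := by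
  have hx1 : x ∈ szlenkDerivative ε (szlenkIter ε K γ) := by
    rw [← szlenkIter_add_one]
    exact szlenkIter_antitone ε K (Order.add_one_le_of_lt hγ) hx
  obtain ⟨U, hU, hUo, hU0⟩ := eventually_nhds_iff.mp hP
  by_contra! hcon
  refine hx1.2 ⟨szlenkIter ε K γ ∩ StrongDual.toWeakDual ⁻¹'
    ((fun w => w - StrongDual.toWeakDual x) ⁻¹' U), ⟨⟨_, hUo.preimage ?_, rfl⟩, ?_⟩, hx1.1, ?_⟩
  · fun_prop
  · refine lt_of_le_of_lt (Metric.ediam_le (d := ENNReal.ofReal (ε / 2)) ?_)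
      ((ENNReal.ofReal_lt_ofReal_iff hε).mpr (half_lt_self hε))
    have key : ∀ z ∈ szlenkIter ε K γ ∩ StrongDual.toWeakDual ⁻¹'
        ((fun w => w - StrongDual.toWeakDual x) ⁻¹' U), dist z x < ε / 4 := by
      rintro z ⟨hz, hzU⟩
      rw [dist_eq_norm]
      by_contra! hfar
      exact hcon z hz hfar (hU _ (by simpa using hzU))
    intro a ha b hb
    rw [edist_dist]
    refine ENNReal.ofReal_le_ofReal ?_
    linarith [dist_triangle_right a b x, key a ha, key b hb]
  · simpa using hU0

/-- In an infinite-dimensional space every weak* neighbourhood of `0` contains a functional of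
norm one. -/
theorem exists_norm_eq_one_of_eventually (hX : ¬ FiniteDimensional ℝ X) {P : WeakDual ℝ X → Prop}
    (hP : ∀ᶠ w in 𝓝 0, P w) : ∃ f : StrongDual ℝ X, ‖f‖ = 1 ∧ P (StrongDual.toWeakDual f) := by
  obtain ⟨s, r, hr, hs⟩ := (WeakDual.withSeminorms (𝕜 := ℝ) (E := X)).mem_nhds_iff 0 _ |>.mp hP
  have hne : Submodule.span ℝ (s : Set X) ≠ ⊤ := fun h =>
    hX (Module.finite_def.mpr ⟨s, h⟩)
  obtain ⟨x, -, hx⟩ := SetLike.exists_of_lt hne.lt_top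
  have hcl : IsClosed (Submodule.span ℝ (s : Set X) : Set X) :=
    (Submodule.span ℝ (s : Set X)).closed_of_finiteDimensional
  have hx' : Submodule.Quotient.mk x ≠ (0 : X ⧸ Submodule.span ℝ (s : Set X)) := by
    rwa [Ne, Submodule.Quotient.mk_eq_zero]
  obtain ⟨g, hg⟩ := SeparatingDual.exists_eq_one (R := ℝ) hx'
  let f : StrongDual ℝ X := g.comp (Submodule.span ℝ (s : Set X)).mkQL
  have hfx : f x = 1 := hg
  have hf0 : f ≠ 0 := fun h => by simp [h] at hfx
  have hfs : ∀ y ∈ s, f y = 0 := fun y hy => by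
    have : (Submodule.Quotient.mk y : X ⧸ Submodule.span ℝ (s : Set X)) = 0 :=
      (Submodule.Quotient.mk_eq_zero _).mpr (Submodule.subset_span hy)
    change g (Submodule.Quotient.mk y) = 0
    rw [this, map_zero]
  refine ⟨‖f‖⁻¹ • f, norm_smul_inv_norm hf0, hs ?_⟩
  rw [Seminorm.mem_ball, sub_zero]
  refine Seminorm.finset_sup_apply_lt hr fun y hy => ?_
  have : StrongDual.toWeakDual (‖f‖⁻¹ • f) y = 0 := by
    change ‖f‖⁻¹ * f y = 0
    rw [hfs y hy, mul_zero]
  rw [WeakDual.seminormFamily_apply, this, norm_zero]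
  exact hr

theorem one_lt_szlenkIndex (hX : ¬ FiniteDimensional ℝ X) :
    ((1 : Ordinal.{u}) : WithTop Ordinal.{u}) < szlenkIndex X := by
  refine lt_szlenkIndex_iff.mpr ⟨1, one_pos, 0, ?_⟩
  rw [← zero_add (1 : Ordinal.{u}), szlenkIter_add_one, szlenkIter_zero]
  refine ⟨Metric.mem_closedBall_self zero_le_one, ?_⟩
  rintro ⟨_, ⟨⟨U, hU, rfl⟩, hd⟩, h0⟩
  obtain ⟨f, hf, hfU⟩ := exists_norm_eq_one_of_eventually hX (P := fun w => w ∈ U)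
    (hU.mem_nhds (by simpa using h0.2))
  have hfB : f ∈ Metric.closedBall (0 : StrongDual ℝ X) 1 := by simp [hf]
  refine (hd.trans_le ?_).not_ge (Metric.edist_le_ediam_of_mem ⟨hfB, hfU⟩ h0)
  rw [edist_dist, dist_zero_right, hf]

end SzlenkFacts

/-! ### Well-founded trees indexed by the natural numbers -/

/-- A countable tree on `ℕ` with root `0` whose nodes carry ordinal labels, such that labels
decrease strictly from parent to child, and every node labelled `γ` has infinitely many children
of each label `β < γ`. Node `m + 1` has parent `par (m + 1) ≤ m`. -/
structure IsOrdinalTree (α : Ordinal.{u}) (lab : ℕ → Ordinal.{u}) (par : ℕ → ℕ) : Prop where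
  lab_zero : lab 0 = α
  par_le : ∀ m, par (m + 1) ≤ m
  lab_lt : ∀ m, lab (m + 1) < lab (par (m + 1))
  exists_child : ∀ n, ∀ β < lab n, ∀ N, ∃ m, N ≤ m ∧ par (m + 1) = n ∧ lab (m + 1) = β

theorem exists_isOrdinalTree {α : Ordinal.{u}} (hα : α < ω₁) (hα0 : α ≠ 0) :
    ∃ (lab : ℕ → Ordinal.{u}) (par : ℕ → ℕ), IsOrdinalTree α lab par := by
  have hc : (Set.Iio α).Countable := by
    rw [← Cardinal.le_aleph0_iff_set_countable, Cardinal.mk_Iio_ordinal,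
      ← Cardinal.lift_aleph0.{u + 1, u}, Cardinal.lift_le, ← Order.lt_succ_iff,
      Cardinal.succ_aleph0, ← Cardinal.lt_ord, Cardinal.ord_aleph]
    exact hα
  have hne : (Set.Iio α).Nonempty := ⟨0, pos_iff_ne_zero.mpr hα0⟩
  obtain ⟨e, he⟩ := hc.exists_eq_range hne
  have he' : ∀ k, e k < α := fun k => by
    have : e k ∈ Set.range e := ⟨k, rfl⟩
    rwa [← he] at this
  -- Node `m + 1` is asked to be a child of `(unpair m).1` with label indexed by the first
  -- component of `(unpair m).2`; the second component only serves to repeat the request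
  -- infinitely often. Requests that cannot be met produce a child of the root instead.
  let lab : ℕ → Ordinal.{u} := fun n =>
    match n with
    | 0 => α
    | m + 1 => e (Nat.unpair (Nat.unpair m).2).1
  let par : ℕ → ℕ := fun n =>
    if lab n < lab (Nat.unpair (n - 1)).1 then (Nat.unpair (n - 1)).1 else 0
  refine ⟨lab, par, rfl, fun m => ?_, fun m => ?_, fun n β hβ N => ?_⟩
  · dsimp only [par]
    split_ifs
    · exact Nat.unpair_left_le m
    · exact Nat.zero_le m
  · dsimp only [par]
    split_ifs with h
    · exact h
    · exact he' _
  · have hle : lab n ≤ α := by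
      cases n with
      | zero => exact le_rfl
      | succ n => exact (he' _).le
    obtain ⟨j, rfl⟩ : β ∈ Set.range e := he ▸ (hβ.trans_le hle : β < α)
    refine ⟨Nat.pair n (Nat.pair j N), ?_, ?_, ?_⟩
    · exact (Nat.right_le_pair j N).trans (Nat.right_le_pair n _)
    · have : lab (Nat.pair n (Nat.pair j N) + 1) = e j := by simp [lab]
      dsimp only [par]
      rw [this]
      simp [hβ]
    · simp [lab]

/-- A tree of functionals in the dual ball, indexed by an ordinal tree, whose branching is
uniformly separated in norm and weak*-null, witnesses that derived sets are nonempty. -/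
theorem IsOrdinalTree.mem_szlenkIter {Y : Type u} [NormedAddCommGroup Y] [NormedSpace ℝ Y]
    {α : Ordinal.{u}} {lab : ℕ → Ordinal.{u}} {par : ℕ → ℕ} (T : IsOrdinalTree α lab par)
    {x : ℕ → StrongDual ℝ Y} (hx : ∀ n, ‖x n‖ ≤ 1) {r : ℝ}
    (hsep : ∀ m, r ≤ ‖x (m + 1) - x (par (m + 1))‖)
    (hnull : ∀ v, Tendsto (fun m => (x (m + 1) - x (par (m + 1))) v) atTop (𝓝 0))
    (β : Ordinal.{u}) : ∀ n, β ≤ lab n → x n ∈ szlenkIter r (Metric.closedBall 0 1) β := by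
  induction β using Ordinal.limitRecOn with
  | zero =>
    intro n _
    rw [szlenkIter_zero, mem_closedBall_zero_iff]
    exact hx n
  | add_one β ih =>
    intro n hn
    rw [szlenkIter_add_one]
    have hβ : β < lab n := Order.add_one_le_iff.mp hn
    refine ⟨ih n hβ.le, ?_⟩
    rintro ⟨_, ⟨⟨U, hU, rfl⟩, hd⟩, hnU⟩
    have hlim : Tendsto (fun m => StrongDual.toWeakDual (x (m + 1) - x (par (m + 1)) + x n)) atTop
        (𝓝 (StrongDual.toWeakDual (x n))) := by
      refine (tendsto_iff_forall_eval_tendsto_topDualPairing).mpr fun v => ?_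
      simpa using! (hnull v).add_const (x n v)
    obtain ⟨N, hN⟩ := eventually_atTop.mp (hlim.eventually (hU.mem_nhds hnU.2))
    obtain ⟨m, hm, hpar, hlab⟩ := T.exists_child n β hβ N
    have hmU := hN m hm
    rw [hpar, sub_add_cancel] at hmU
    refine (hd.trans_le ?_).not_ge
      (Metric.edist_le_ediam_of_mem ⟨ih (m + 1) hlab.ge, hmU⟩ hnU)
    rw [edist_dist, dist_eq_norm]
    exact ENNReal.ofReal_le_ofReal (hpar ▸ hsep m)
  | limit β hβ ih =>
    intro n hn
    rw [szlenkIter_limit _ _ hβ]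
    exact Set.mem_iInter₂.mpr fun γ hγ => ih γ hγ n (hγ.le.trans hn)

/-- Dependent choice for properties of finite initial segments: `Q n f` speaks of the values of
`f` at arguments at most `n`. -/
theorem exists_seq_of_forall_update {A : Type*} [Nonempty A] (Q : ℕ → (ℕ → A) → Prop)
    (hcongr : ∀ n f g, (∀ k ≤ n, f k = g k) → Q n f → Q n g)
    (hstep : ∀ n f, (∀ k < n, Q k f) → ∃ a, Q n (Function.update f n a)) :
    ∃ f, ∀ n, Q n f := by
  have hstep' : ∀ n (f : ℕ → A), ∃ a, (∀ k < n, Q k f) → Q n (Function.update f n a) := by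
    intro n f
    by_cases h : ∀ k < n, Q k f
    · exact (hstep n f h).imp fun a ha _ => ha
    · exact ⟨Classical.arbitrary A, fun h' => absurd h' h⟩
  choose c hc using hstep'
  let F : ℕ → ℕ → A := fun n => Nat.rec (fun _ => Classical.arbitrary A)
    (fun n f => Function.update f n (c n f)) n
  have hF : ∀ n, F (n + 1) = Function.update (F n) n (c n (F n)) := fun n => rfl
  have hstab : ∀ n m k, n ≤ m → k < n → F m k = F n k := by
    intro n m k hnm hk
    induction m, hnm using Nat.le_induction with
    | base => rfl
    | succ m hm ih => rw [hF, Function.update_of_ne (hk.trans_le hm).ne, ih]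
  have hQ : ∀ n, Q n (F (n + 1)) := by
    intro n
    induction n using Nat.strong_induction_on with
    | _ n ih =>
      rw [hF]
      refine hc n (F n) fun k hk => ?_
      exact hcongr k _ _ (fun j hj => (hstab (k + 1) n j hk (Nat.lt_succ_of_le hj)).symm) (ih k hk)
  refine ⟨fun n => F (n + 1) n, fun n => hcongr n _ _ (fun k hk => ?_) (hQ n)⟩
  exact hstab (k + 1) (n + 1) k (Nat.succ_le_succ hk) (Nat.lt_succ_self k)

/-! ### Basic sequences -/

section Basic

variable {E : Type*} [NormedAddCommGroup E] [NormedSpace ℝ E]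

theorem exists_dual_eq_one_of_notMem {p : Submodule ℝ E} (hp : IsClosed (p : Set E)) {x : E}
    (hx : x ∉ p) : ∃ f : StrongDual ℝ E, f x = 1 ∧ ∀ y ∈ p, f y = 0 := by
  have hx' : Submodule.Quotient.mk x ≠ (0 : E ⧸ p) := by
    rwa [Ne, Submodule.Quotient.mk_eq_zero]
  obtain ⟨g, hg⟩ := SeparatingDual.exists_eq_one (R := ℝ) hx'
  refine ⟨g.comp p.mkQL, hg, fun y hy => ?_⟩
  change g (Submodule.Quotient.mk y) = 0
  rw [(Submodule.Quotient.mk_eq_zero p).mpr hy, map_zero]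

theorem topologicalClosure_span_eq_top {e : ℕ → E}
    (h : ∀ f : StrongDual ℝ E, (∀ i, f (e i) = 0) → f = 0) :
    (Submodule.span ℝ (Set.range e)).topologicalClosure = ⊤ := by
  by_contra hne
  obtain ⟨x, -, hx⟩ := SetLike.exists_of_lt (lt_top_iff_ne_top.mpr hne)
  obtain ⟨f, hfx, hf⟩ :=
    exists_dual_eq_one_of_notMem (Submodule.isClosed_topologicalClosure _) hx
  rw [h f fun i => hf _ (Submodule.le_topologicalClosure _ (Submodule.subset_span ⟨i, rfl⟩))] at hfx
  simp at hfx

theorem exists_eq_sum_of_mem_span_range {u : ℕ → E} {v : E}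
    (hv : v ∈ Submodule.span ℝ (Set.range u)) :
    ∃ (m : ℕ) (a : ℕ → ℝ), v = ∑ i ∈ Finset.range m, a i • u i := by
  obtain ⟨c, rfl⟩ := Finsupp.mem_span_range_iff_exists_finsupp.mp hv
  obtain ⟨m, hm⟩ := c.support.exists_nat_subset_range
  exact ⟨m, c, Finsupp.sum_of_support_subset c hm _ (by simp)⟩

/-- Pointwise convergence to `0` of a bounded sequence of functionals may be tested on a set with
dense span. -/
theorem tendsto_zero_of_dense_span {d : ℕ → StrongDual ℝ E} {M : ℝ} (hd : ∀ m, ‖d m‖ ≤ M)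
    {s : Set E} (hs : (Submodule.span ℝ s).topologicalClosure = ⊤)
    (h : ∀ v ∈ s, Tendsto (fun m => d m v) atTop (𝓝 0)) (v : E) :
    Tendsto (fun m => d m v) atTop (𝓝 0) := by
  have hM : 0 ≤ M := (norm_nonneg _).trans (hd 0)
  have hspan : ∀ w ∈ Submodule.span ℝ s, Tendsto (fun m => d m w) atTop (𝓝 0) := by
    intro w hw
    induction hw using Submodule.span_induction with
    | mem w hw => exact h w hw
    | zero => simp
    | add x y _ _ hx hy => simpa using hx.add hy
    | smul c x _ hx => simpa using hx.const_mul c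
  have hv : v ∈ closure (Submodule.span ℝ s : Set E) := by
    rw [← Submodule.topologicalClosure_coe, hs]; trivial
  rw [Metric.tendsto_atTop]
  intro δ hδ
  obtain ⟨w, hw, hvw⟩ := Metric.mem_closure_iff.mp hv (δ / (2 * (M + 1))) (by positivity)
  obtain ⟨N, hN⟩ := Metric.tendsto_atTop.mp (hspan w hw) (δ / 2) (by positivity)
  refine ⟨N, fun m hm => ?_⟩
  have h1 := hN m hm
  rw [dist_zero_right] at h1 ⊢
  rw [dist_eq_norm, lt_div_iff₀ (by positivity)] at hvw
  have h2 : ‖d m (v - w)‖ ≤ M * ‖v - w‖ := (d m).le_of_opNorm_le (hd m) _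
  have h3 : d m v = d m (v - w) + d m w := by simp
  rw [h3]
  have := norm_add_le (d m (v - w)) (d m w)
  nlinarith [norm_nonneg (v - w)]

variable {u : ℕ → E} {f : ℕ → StrongDual ℝ E} {C : ℝ}

theorem sum_coord_eq (hfu : ∀ i j, f i (u j) = if i = j then 1 else 0) {n m : ℕ} (hnm : n ≤ m)
    (a : ℕ → ℝ) :
    ∑ i ∈ Finset.range n, f i (∑ j ∈ Finset.range m, a j • u j) • u i =
      ∑ i ∈ Finset.range n, a i • u i := by
  refine Finset.sum_congr rfl fun i hi => ?_
  have hi' : i < m := (Finset.mem_range.mp hi).trans_le hnm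
  simp [hfu, hi']

/-- If the partial sum operators of a biorthogonal system are uniformly bounded, then they converge
to the identity on the closed span of the system. -/
theorem tendsto_sum_coord (hfu : ∀ i j, f i (u j) = if i = j then 1 else 0)
    (hC : ∀ n, ∀ v ∈ (Submodule.span ℝ (Set.range u)).topologicalClosure,
      ‖∑ i ∈ Finset.range n, f i v • u i‖ ≤ C * ‖v‖) {v : E}
    (hv : v ∈ (Submodule.span ℝ (Set.range u)).topologicalClosure) :
    Tendsto (fun n => ∑ i ∈ Finset.range n, f i v • u i) atTop (𝓝 v) := by
  rw [Metric.tendsto_atTop]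
  intro δ hδ
  obtain ⟨w, hw, hvw⟩ := Metric.mem_closure_iff.mp hv (δ / (|C| + 2)) (by positivity)
  obtain ⟨m, a, rfl⟩ := exists_eq_sum_of_mem_span_range hw
  refine ⟨m, fun n hn => ?_⟩
  set w := ∑ i ∈ Finset.range m, a i • u i with hwdef
  have hSw : ∑ i ∈ Finset.range n, f i w • u i = w := by
    rw [hwdef, ← Finset.sum_subset (Finset.range_subset_range.mpr hn), sum_coord_eq hfu le_rfl]
    intro i _ hi
    have : f i (∑ j ∈ Finset.range m, a j • u j) = 0 := by
      rw [map_sum]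
      refine Finset.sum_eq_zero fun j hj => ?_
      rw [map_smul, hfu, if_neg (fun h : i = j => hi (h ▸ hj)), smul_zero]
    rw [this, zero_smul]
  have h1 := hC n (v - w) (Submodule.sub_mem _ hv (Submodule.le_topologicalClosure _ hw))
  have h2 : ∑ i ∈ Finset.range n, f i v • u i - v =
      ∑ i ∈ Finset.range n, f i (v - w) • u i - (v - w) := by
    simp only [map_sub, sub_smul, Finset.sum_sub_distrib, hSw]
    abel
  rw [dist_eq_norm, h2]
  rw [dist_eq_norm, lt_div_iff₀ (by positivity)] at hvw
  have h3 := norm_sub_le (∑ i ∈ Finset.range n, f i (v - w) • u i) (v - w)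
  have h4 : C * ‖v - w‖ ≤ |C| * ‖v - w‖ :=
    mul_le_mul_of_nonneg_right (le_abs_self C) (norm_nonneg _)
  nlinarith [norm_nonneg (v - w)]

/-- A fundamental biorthogonal system with uniformly bounded partial sum operators is a Schauder
basis. -/
theorem nonempty_schauderBasis (hfu : ∀ i j, f i (u j) = if i = j then 1 else 0)
    (hu : (Submodule.span ℝ (Set.range u)).topologicalClosure = ⊤)
    (hC : ∀ n v, ‖∑ i ∈ Finset.range n, f i v • u i‖ ≤ C * ‖v‖) :
    Nonempty (SchauderBasis ℝ E) :=
  ⟨{ basis := u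
     coord := f
     ortho := fun i j => by
      rcases eq_or_ne i j with rfl | h
      · simp [hfu]
      · simp [hfu, h]
     expansion := fun v => by
      rw [HasSum, SummationFilter.conditional_filter_eq_map_range, tendsto_map'_iff]
      exact tendsto_sum_coord hfu (fun n v _ => hC n v) (hu ▸ Submodule.mem_top) }⟩

theorem SchauderBasis.not_finiteDimensional (b : SchauderBasis ℝ E) :
    ¬ FiniteDimensional ℝ E := by
  intro h
  exact Infinite.not_finite (LinearIndependent.finite (GeneralSchauderBasis.linearIndependent b))

/-- Weights increasing from `1` towards `2`; the ratio of consecutive weights is the admissible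
loss at each step of the construction of a basic sequence. -/
noncomputable def basisWeight (n : ℕ) : ℝ := 2 - 1 / ((n : ℝ) + 1)

theorem one_le_basisWeight (n : ℕ) : 1 ≤ basisWeight n := by
  have : 1 / ((n : ℝ) + 1) ≤ 1 := by
    rw [div_le_one (by positivity)]
    linarith [n.cast_nonneg (α := ℝ)]
  unfold basisWeight
  linarith

theorem basisWeight_le_two (n : ℕ) : basisWeight n ≤ 2 := by
  have : 0 ≤ 1 / ((n : ℝ) + 1) := by positivity
  unfold basisWeight
  linarith

theorem basisWeight_lt_succ (n : ℕ) : basisWeight n < basisWeight (n + 1) := by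
  have : 1 / (((n + 1 : ℕ) : ℝ) + 1) < 1 / ((n : ℝ) + 1) :=
    one_div_lt_one_div_of_lt (by positivity) (by push_cast; linarith)
  unfold basisWeight
  linarith

/-- The `n`-th term of the sequence `u` is almost orthogonal, in the sense of Birkhoff and James,
to the span of the preceding ones: adding a multiple of it decreases norms by at most the factor
`basisWeight n / basisWeight (n + 1)`. -/
def AlmostOrthogonalAt (u : ℕ → E) (n : ℕ) : Prop :=
  ∀ v ∈ Submodule.span ℝ (u '' Set.Iio n), ∀ t : ℝ,
    basisWeight n * ‖v‖ ≤ basisWeight (n + 1) * ‖v + t • u n‖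

theorem AlmostOrthogonalAt.congr {u u' : ℕ → E} {n : ℕ} (h : AlmostOrthogonalAt u n)
    (huu : ∀ k ≤ n, u k = u' k) : AlmostOrthogonalAt u' n := by
  have him : u' '' Set.Iio n = u '' Set.Iio n :=
    Set.image_congr fun k hk => (huu k (le_of_lt hk)).symm
  intro v hv t
  rw [him] at hv
  rw [← huu n le_rfl]
  exact h v hv t

/-- Grunblum's condition with constant `2`. -/
theorem norm_sum_le_of_almostOrthogonal (hu : ∀ n, AlmostOrthogonalAt u n) (a : ℕ → ℝ) {n m : ℕ}
    (hnm : n ≤ m) :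
    ‖∑ i ∈ Finset.range n, a i • u i‖ ≤ 2 * ‖∑ i ∈ Finset.range m, a i • u i‖ := by
  have key : basisWeight n * ‖∑ i ∈ Finset.range n, a i • u i‖ ≤
      basisWeight m * ‖∑ i ∈ Finset.range m, a i • u i‖ := by
    induction m, hnm using Nat.le_induction with
    | base => exact le_rfl
    | succ m _ ih =>
      rw [Finset.sum_range_succ]
      refine ih.trans (hu m _ ?_ _)
      exact Submodule.sum_mem _ fun i hi => Submodule.smul_mem _ _
        (Submodule.subset_span ⟨i, Finset.mem_range.mp hi, rfl⟩)
  have h1 := mul_le_mul_of_nonneg_right (one_le_basisWeight n)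
    (norm_nonneg (∑ i ∈ Finset.range n, a i • u i))
  have h2 := mul_le_mul_of_nonneg_right (basisWeight_le_two m)
    (norm_nonneg (∑ i ∈ Finset.range m, a i • u i))
  linarith

/-- A sequence of nonzero almost orthogonal vectors has continuous biorthogonal functionals, and its
partial sum operators are bounded by `2` on its closed span. -/
theorem exists_biorthogonal (hu : ∀ n, AlmostOrthogonalAt u n) (hu0 : ∀ n, u n ≠ 0) :
    ∃ f : ℕ → StrongDual ℝ E, (∀ i j, f i (u j) = if i = j then 1 else 0) ∧
      ∀ n, ∀ v ∈ (Submodule.span ℝ (Set.range u)).topologicalClosure,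
        ‖∑ i ∈ Finset.range n, f i v • u i‖ ≤ 2 * ‖v‖ := by
  -- Grunblum's condition bounds the `n`-th term of a sum by four times the norm of the sum, so `u n`
  -- has distance at least `‖u n‖ / 4` from the span of the other vectors.
  have hnot : ∀ n, u n ∉ (Submodule.span ℝ (u '' {n}ᶜ)).topologicalClosure := by
    intro n hn
    have hpos := norm_pos_iff.mpr (hu0 n)
    obtain ⟨w, hw, hdist⟩ := Metric.mem_closure_iff.mp hn (‖u n‖ / 4) (by positivity)
    obtain ⟨c, hc, rfl⟩ := (Finsupp.mem_span_image_iff_linearCombination ℝ).mp hw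
    have hcn : c n = 0 := by
      by_contra hne
      exact (Finsupp.mem_supported ℝ c).mp hc (Finsupp.mem_support_iff.mpr hne) rfl
    obtain ⟨m, hm⟩ := c.support.exists_nat_subset_range
    have hsum : u n - Finsupp.linearCombination ℝ u c =
        ∑ i ∈ Finset.range (max m (n + 1)), ((if i = n then 1 else 0) - c i) • u i := by
      rw [Finsupp.linearCombination_apply, Finsupp.sum_of_support_subset c
        (hm.trans (Finset.range_subset_range.mpr (le_max_left m (n + 1)))) _ (by simp)]
      simp [sub_smul, Finset.sum_sub_distrib]
    set a : ℕ → ℝ := fun i => (if i = n then 1 else 0) - c i with ha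
    have h1 := norm_sum_le_of_almostOrthogonal hu a (n := n) (m := max m (n + 1)) (by omega)
    have h2 := norm_sum_le_of_almostOrthogonal hu a (n := n + 1) (m := max m (n + 1)) (by omega)
    have h3 : u n = ∑ i ∈ Finset.range (n + 1), a i • u i - ∑ i ∈ Finset.range n, a i • u i := by
      rw [Finset.sum_range_succ, add_sub_cancel_left]
      simp [ha, hcn]
    have h4 := norm_sub_le (∑ i ∈ Finset.range (n + 1), a i • u i)
      (∑ i ∈ Finset.range n, a i • u i)
    rw [← h3] at h4
    rw [dist_eq_norm, hsum] at hdist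
    linarith
  choose f hf1 hf0 using fun n =>
    exists_dual_eq_one_of_notMem (Submodule.isClosed_topologicalClosure _) (hnot n)
  have hfu : ∀ i j, f i (u j) = if i = j then 1 else 0 := by
    intro i j
    split_ifs with h
    · rw [← h, hf1]
    · exact hf0 i _ (Submodule.le_topologicalClosure _ (Submodule.subset_span ⟨j, Ne.symm h, rfl⟩))
  refine ⟨f, hfu, fun n v hv => ?_⟩
  have hclosed : IsClosed {v : E | ‖∑ i ∈ Finset.range n, f i v • u i‖ ≤ 2 * ‖v‖} :=
    isClosed_le (by fun_prop) (by fun_prop)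
  refine hclosed.closure_subset_iff.mpr ?_ hv
  intro w hw
  obtain ⟨m, a, rfl⟩ := exists_eq_sum_of_mem_span_range hw
  rcases le_total n m with h | h
  · rw [Set.mem_ofPred_eq, sum_coord_eq hfu h]
    exact norm_sum_le_of_almostOrthogonal hu a h
  · -- Coefficients beyond `m` may be taken to be zero, so that `n ≤ m` without loss of generality.
    have hext : ∑ i ∈ Finset.range m, a i • u i =
        ∑ i ∈ Finset.range n, (if i < m then a i else 0) • u i := by
      rw [← Finset.sum_subset (Finset.range_subset_range.mpr h)]
      · exact Finset.sum_congr rfl fun i hi => by rw [if_pos (Finset.mem_range.mp hi)]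
      · intro i _ hi
        rw [if_neg (fun h' => hi (Finset.mem_range.mpr h')), zero_smul]
    rw [Set.mem_ofPred_eq, hext, sum_coord_eq hfu le_rfl]
    exact norm_sum_le_of_almostOrthogonal hu _ le_rfl

end Basic

/-! ### Mazur's selection principle -/

/-- Mazur's lemma: finitely many elements of a norming set of functionals almost norm a
finite-dimensional subspace `F`, and a vector bounded below in norm on which all of them are small
is almost orthogonal to `F`. -/
theorem exists_finite_forall_almostOrthogonal {E : Type*} [NormedAddCommGroup E] [NormedSpace ℝ E]
    (F : Submodule ℝ E) [FiniteDimensional ℝ F] {D : Set (StrongDual ℝ E)}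
    (hD : ∀ g ∈ D, ‖g‖ ≤ 1) (hnorm : ∀ v : E, ∀ s < ‖v‖, ∃ g ∈ D, s < g v)
    {θ : ℝ} (hθ : θ < 1) {r : ℝ} (hr : 0 < r) :
    ∃ G ⊆ D, G.Finite ∧ ∃ η > 0, ∀ y : E, r ≤ ‖y‖ → (∀ g ∈ G, |g y| ≤ η) →
      ∀ v ∈ F, ∀ t : ℝ, θ * ‖v‖ ≤ ‖v + t • y‖ := by
  have hcomp : IsCompact (F.subtypeL '' Metric.sphere (0 : F) 1) :=
    (isCompact_sphere (0 : F) 1).image F.subtypeL.continuous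
  obtain ⟨G, hGD, hGfin, hG⟩ := hcomp.elim_finite_subcover_image (b := D)
    (c := fun g => {v : E | (1 + θ) / 2 < g v})
    (fun g _ => isOpen_lt continuous_const g.continuous) (by
      rintro _ ⟨v, hv, rfl⟩
      obtain ⟨g, hg, hgv⟩ := hnorm (F.subtypeL v) ((1 + θ) / 2) (by
        rw [mem_sphere_zero_iff_norm] at hv
        have : ‖F.subtypeL v‖ = 1 := hv
        rw [this]; linarith)
      exact Set.mem_biUnion hg hgv)
  refine ⟨G, hGD, hGfin, (1 - θ) * r / 4, by nlinarith, fun y hy hGy => ?_⟩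
  have unit : ∀ v ∈ F, ‖v‖ = 1 → ∀ t : ℝ, θ ≤ ‖v + t • y‖ := by
    intro v hv hv1 t
    rcases le_total 2 (|t| * r) with h | h
    · -- A large multiple of `y` dominates `v`.
      have h1 : ‖t • y‖ - ‖v‖ ≤ ‖v + t • y‖ := by
        have := norm_sub_norm_le (t • y) (-v)
        rwa [norm_neg, sub_neg_eq_add, add_comm (t • y)] at this
      rw [norm_smul, Real.norm_eq_abs] at h1
      nlinarith [abs_nonneg t]
    · obtain ⟨g, hg, hgv⟩ := Set.mem_iUnion₂.mp
        (hG ⟨⟨v, hv⟩, by simpa using hv1, rfl⟩)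
      have hgv' : (1 + θ) / 2 < g v := hgv
      have h1 : g (v + t • y) ≤ ‖v + t • y‖ :=
        (le_abs_self _).trans (by simpa using g.le_of_opNorm_le (hD g (hGD hg)) (v + t • y))
      have h2 : |t * g y| ≤ (1 - θ) / 2 := by
        rw [abs_mul]
        have := mul_le_mul_of_nonneg_left (hGy g hg) (abs_nonneg t)
        nlinarith
      have h3 : g (v + t • y) = g v + t * g y := by simp
      linarith [neg_abs_le (t * g y)]
  intro v hv t
  rcases eq_or_ne v 0 with rfl | hv0
  · simp
  · have hpos := norm_pos_iff.mpr hv0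
    have h1 := unit (‖v‖⁻¹ • v) (F.smul_mem _ hv) (by
      rw [norm_smul, norm_inv, norm_norm, inv_mul_cancel₀ hpos.ne']) (‖v‖⁻¹ * t)
    rw [mul_smul, ← smul_add, norm_smul, norm_inv, norm_norm, inv_mul_eq_div,
      le_div_iff₀ hpos] at h1
    exact h1

section Dual

variable {X : Type u} [NormedAddCommGroup X] [NormedSpace ℝ X]

theorem eventually_abs_apply_le (x : X) {η : ℝ} (hη : 0 < η) :
    ∀ᶠ w in 𝓝 (0 : WeakDual ℝ X), |w x| ≤ η := by
  have hc : Tendsto (fun w : WeakDual ℝ X => |w x|) (𝓝 0) (𝓝 |(0 : StrongDual ℝ X) x|) :=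
    (WeakDual.eval_continuous (𝕜 := ℝ) x).abs.tendsto 0
  rw [zero_apply, abs_zero] at hc
  exact (hc.eventually (gt_mem_nhds hη)).mono fun w hw => le_of_lt hw

/-- Mazur's lemma in a dual space: functionals close to `0` in the weak* topology and bounded below
in norm are almost orthogonal to a given finite-dimensional space of functionals. -/
theorem eventually_almostOrthogonal (F : Submodule ℝ (StrongDual ℝ X)) [FiniteDimensional ℝ F]
    {θ : ℝ} (hθ : θ < 1) {r : ℝ} (hr : 0 < r) :
    ∀ᶠ w in 𝓝 (0 : WeakDual ℝ X), r ≤ ‖WeakDual.toStrongDual w‖ →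
      ∀ v ∈ F, ∀ t : ℝ, θ * ‖v‖ ≤ ‖v + t • WeakDual.toStrongDual w‖ := by
  obtain ⟨G, hGD, hGfin, η, hη, h⟩ := exists_finite_forall_almostOrthogonal F
    (D := NormedSpace.inclusionInDoubleDual ℝ X '' Metric.closedBall 0 1) (by
      rintro _ ⟨x, hx, rfl⟩
      exact (NormedSpace.double_dual_bound ℝ X x).trans (mem_closedBall_zero_iff.mp hx)) (by
      intro v s hs
      obtain ⟨x, hx, hsx⟩ := v.exists_lt_apply_of_lt_opNorm hs
      rw [Real.norm_eq_abs] at hsx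
      rcases lt_abs.mp hsx with h | h
      · exact ⟨_, ⟨x, by simpa using hx.le, rfl⟩, h⟩
      · exact ⟨_, ⟨-x, by simpa using hx.le, rfl⟩, by simpa using h⟩) hθ hr
  have hsmall : ∀ g ∈ G, ∀ᶠ w in 𝓝 (0 : WeakDual ℝ X), |g (WeakDual.toStrongDual w)| ≤ η := by
    intro g hg
    obtain ⟨x, -, rfl⟩ := hGD hg
    exact eventually_abs_apply_le x hη
  filter_upwards [(hGfin.eventually_all).mpr hsmall] with w hw hrw
  exact h _ hrw hw

/-- A functional at distance more than `s` from the span of finitely many functionals is at least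
`s` at some vector of the unit ball on which these all vanish. -/
theorem exists_forall_eq_zero_le_apply {G : Set (StrongDual ℝ X)} (hG : G.Finite)
    {w : StrongDual ℝ X} {s : ℝ}
    (hw : ∀ g ∈ Submodule.span ℝ G, s < ‖w - g‖) :
    ∃ y : X, ‖y‖ ≤ 1 ∧ (∀ g ∈ G, g y = 0) ∧ s ≤ w y := by
  let N : Submodule ℝ X := ⨅ g : G, (g : StrongDual ℝ X).toLinearMap.ker
  obtain ⟨φ, hφ, hφn⟩ := exists_extension_norm_eq N (w.comp N.subtypeL)
  have hspan : w - φ ∈ Submodule.span ℝ G := by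
    have := hG.to_subtype
    have h1 : (w - φ).toLinearMap ∈ Submodule.span ℝ
        (Set.range fun g : G => (g : StrongDual ℝ X).toLinearMap) := by
      refine mem_span_of_iInf_ker_le_ker fun x hx => ?_
      have := hφ ⟨x, hx⟩
      simp only [LinearMap.mem_ker]
      change w x - φ x = 0
      rw [this]
      exact sub_self _
    have h2 : Submodule.span ℝ (Set.range fun g : G => (g : StrongDual ℝ X).toLinearMap) =
        (Submodule.span ℝ G).map (ContinuousLinearMap.coeLM ℝ) := by
      rw [Submodule.map_span]
      congr 1
      ext l
      simp
    rw [h2] at h1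
    obtain ⟨g, hg, hgw⟩ := h1
    rwa [← ContinuousLinearMap.coe_injective hgw]
  have hlt := hw _ hspan
  rw [sub_sub_cancel, hφn] at hlt
  obtain ⟨y, hy, hsy⟩ := ContinuousLinearMap.exists_lt_apply_of_lt_opNorm _ hlt
  have hker : ∀ g ∈ G, g (y : X) = 0 := fun g hg => (Submodule.mem_iInf _).mp y.2 ⟨g, hg⟩
  have hsy' : s < |w y| := hsy
  rcases lt_abs.mp hsy' with h | h
  · exact ⟨y, hy.le, hker, h.le⟩
  · exact ⟨-y, by simpa using hy.le, fun g hg => by simp [hker g hg], by simpa using h.le⟩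

/-- One branching step: below a point `x` of a derived set there is `z` in any earlier derived set,
such that `z - x` is weak*-small, bounded below, and almost orthogonal to a given
finite-dimensional space of functionals, and is moreover large at some `y` in the unit ball that is
almost orthogonal to a given finite-dimensional subspace of `X`. -/
theorem exists_branch {ε : ℝ} (hε : 0 < ε) {β γ : Ordinal.{u}} (hγ : γ < β) {x : StrongDual ℝ X}
    (hx : x ∈ szlenkIter ε (Metric.closedBall 0 1) β) (F : Submodule ℝ (StrongDual ℝ X))
    [FiniteDimensional ℝ F] (F' : Submodule ℝ X) [FiniteDimensional ℝ F'] {S : Set X}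
    (hS : S.Finite) {θ δ : ℝ} (hθ : θ < 1) (hδ : 0 < δ) :
    ∃ z ∈ szlenkIter ε (Metric.closedBall 0 1) γ, ∃ y : X, ε / 4 ≤ ‖z - x‖ ∧ ‖y‖ ≤ 1 ∧
      ε / 16 ≤ (z - x) y ∧ (∀ s ∈ S, |(z - x) s| ≤ δ) ∧
      (∀ v ∈ F, ∀ t : ℝ, θ * ‖v‖ ≤ ‖v + t • (z - x)‖) ∧
      (∀ v ∈ F', ∀ t : ℝ, θ * ‖v‖ ≤ ‖v + t • y‖) := by
  -- The vector `y` will satisfy `ε / 16 ≤ (z - x) y` with `‖z - x‖ ≤ 2`, whence `ε / 32 ≤ ‖y‖`.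
  obtain ⟨G, -, hGfin, η, hη, hG⟩ := exists_finite_forall_almostOrthogonal F'
    (D := Metric.closedBall 0 1) (fun g hg => mem_closedBall_zero_iff.mp hg) (by
      intro v s hs
      obtain ⟨g, hg, hgv⟩ := exists_dual_vector'' ℝ v
      refine ⟨g, mem_closedBall_zero_iff.mpr hg, ?_⟩
      rw [hgv]
      exact hs) hθ (r := ε / 32) (by positivity)
  have hfd : FiniteDimensional ℝ (Submodule.span ℝ G) := FiniteDimensional.span_of_finite ℝ hGfin
  have hsmall : ∀ᶠ w in 𝓝 (0 : WeakDual ℝ X), ∀ s ∈ S, |w s| ≤ δ :=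
    (hS.eventually_all).mpr fun s _ => eventually_abs_apply_le s hδ
  obtain ⟨z, hz, hzx, h1, h2, h3⟩ := exists_mem_szlenkIter_far hε hγ hx
    ((eventually_almostOrthogonal F hθ (r := ε / 4) (by positivity)).and
      ((eventually_almostOrthogonal (Submodule.span ℝ G) (θ := 1 / 2) (by norm_num)
        (r := ε / 4) (by positivity)).and hsmall))
  replace h1 := h1 hzx
  replace h2 := h2 hzx
  -- Almost orthogonality to `span G` keeps `z - x` away from `span G`.
  obtain ⟨y, hy, hGy, hwy⟩ := exists_forall_eq_zero_le_apply hGfin (w := z - x) (s := ε / 16)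
    (by
      intro g hg
      have h4 : 1 / 2 * ‖-g‖ ≤ ‖-g + (1 : ℝ) • (z - x)‖ := h2 (-g) (Submodule.neg_mem _ hg) 1
      rw [one_smul, norm_neg, neg_add_eq_sub] at h4
      have h5 := norm_add_le (z - x - g) g
      rw [sub_add_cancel] at h5
      linarith)
  refine ⟨z, hz, y, hzx, hy, hwy, h3, h1, hG y ?_ fun g hg => ?_⟩
  · have hball : ∀ β', ∀ v ∈ szlenkIter ε (Metric.closedBall (0 : StrongDual ℝ X) 1) β',
        ‖v‖ ≤ 1 := by
      intro β' v hv
      have := szlenkIter_antitone ε _ (zero_le (a := β')) hv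
      rw [szlenkIter_zero] at this
      exact mem_closedBall_zero_iff.mp this
    have h4 : ‖z - x‖ ≤ 2 := by
      linarith [norm_sub_le z x, hball _ z hz, hball _ x hx]
    have h5 := (le_abs_self _).trans ((z - x).le_of_opNorm_le h4 y)
    linarith
  · rw [hGy g hg, abs_zero]
    exact hη.le

end Dual

/-! ### Trees with almost orthogonal branches -/

section Selection

variable {X : Type u} [NormedAddCommGroup X] [NormedSpace ℝ X]

/-- The difference between the value at node `m + 1` and the value at its parent. -/
def branch (par : ℕ → ℕ) (x : ℕ → StrongDual ℝ X) (m : ℕ) : StrongDual ℝ X :=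
  x (m + 1) - x (par (m + 1))

/-- A tree of functionals `x` in the dual ball with separated branches, together with vectors `y` of
the unit ball on which the branches are large; the branches and the vectors both form almost
orthogonal sequences, and the branches tend to `0` on each of the vectors. -/
structure IsBasicTree (par : ℕ → ℕ) (r : ℝ) (x : ℕ → StrongDual ℝ X) (y : ℕ → X) : Prop where
  norm_le : ∀ n, ‖x n‖ ≤ 1
  le_norm_branch : ∀ m, r ≤ ‖branch par x m‖
  norm_vec_le : ∀ m, ‖y m‖ ≤ 1
  le_branch_apply : ∀ m, r ≤ branch par x m (y m)
  abs_branch_apply_le : ∀ m, ∀ k < m, |branch par x m (y k)| ≤ 1 / ((m : ℝ) + 1)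
  branch_almostOrthogonal : ∀ m, AlmostOrthogonalAt (branch par x) m
  vec_almostOrthogonal : ∀ m, AlmostOrthogonalAt y m

theorem almostOrthogonalAt_of_forall {E : Type*} [NormedAddCommGroup E] [NormedSpace ℝ E]
    {u : ℕ → E} {n : ℕ}
    (h : ∀ v ∈ Submodule.span ℝ (u '' Set.Iio n), ∀ t : ℝ,
      basisWeight n / basisWeight (n + 1) * ‖v‖ ≤ ‖v + t • u n‖) : AlmostOrthogonalAt u n := by
  intro v hv t
  have hpos : 0 < basisWeight (n + 1) := one_pos.trans_le (one_le_basisWeight _)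
  have := mul_le_mul_of_nonneg_left (h v hv t) hpos.le
  rwa [← mul_assoc, mul_div_cancel₀ _ hpos.ne'] at this

theorem IsOrdinalTree.exists_isBasicTree {α : Ordinal.{u}} {lab : ℕ → Ordinal.{u}} {par : ℕ → ℕ}
    (T : IsOrdinalTree α lab par) {ε : ℝ} (hε : 0 < ε)
    (hne : (szlenkIter ε (Metric.closedBall (0 : StrongDual ℝ X) 1) α).Nonempty) :
    ∃ (x : ℕ → StrongDual ℝ X) (y : ℕ → X), IsBasicTree par (ε / 16) x y := by
  obtain ⟨x₀, hx₀⟩ := hne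
  -- The pair chosen at stage `n` consists of `x n` and of `y (n - 1)`.
  let br : (ℕ → StrongDual ℝ X × X) → ℕ → StrongDual ℝ X := fun f => branch par fun n => (f n).1
  let vec : (ℕ → StrongDual ℝ X × X) → ℕ → X := fun f m => (f (m + 1)).2
  let Q' : ℕ → (ℕ → StrongDual ℝ X × X) → Prop := fun m f =>
    ε / 4 ≤ ‖br f m‖ ∧ ‖vec f m‖ ≤ 1 ∧ ε / 16 ≤ br f m (vec f m) ∧
      (∀ k < m, |br f m (vec f k)| ≤ 1 / ((m : ℝ) + 1)) ∧
      AlmostOrthogonalAt (br f) m ∧ AlmostOrthogonalAt (vec f) m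
  let Q : ℕ → (ℕ → StrongDual ℝ X × X) → Prop := fun n f =>
    (f n).1 ∈ szlenkIter ε (Metric.closedBall 0 1) (lab n) ∧ ∀ m, n = m + 1 → Q' m f
  have hbr : ∀ m (f g : ℕ → StrongDual ℝ X × X), (∀ k ≤ m + 1, f k = g k) →
      ∀ k ≤ m, br f k = br g k := by
    intro m f g h k hk
    simp only [br, branch]
    rw [h (k + 1) (by omega), h (par (k + 1)) ((T.par_le k).trans (by omega))]
  have hvec : ∀ m (f g : ℕ → StrongDual ℝ X × X), (∀ k ≤ m + 1, f k = g k) →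
      ∀ k ≤ m, vec f k = vec g k := by
    intro m f g h k hk
    simp only [vec]
    rw [h (k + 1) (by omega)]
  obtain ⟨f, hf⟩ := exists_seq_of_forall_update Q (by
    rintro n f g hfg ⟨h1, h2⟩
    refine ⟨hfg n le_rfl ▸ h1, ?_⟩
    rintro m rfl
    obtain ⟨h3, h4, h5, h6, h7, h8⟩ := h2 m rfl
    have hb := hbr m f g hfg
    have hv := hvec m f g hfg
    refine ⟨hb m le_rfl ▸ h3, hv m le_rfl ▸ h4, hb m le_rfl ▸ hv m le_rfl ▸ h5, ?_,
      h7.congr hb, h8.congr hv⟩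
    intro k hk
    rw [← hb m le_rfl, ← hv k hk.le]
    exact h6 k hk) (by
    rintro n f hprev
    cases n with
    | zero =>
      refine ⟨(x₀, 0), ?_, fun m hm => absurd hm (by omega)⟩
      rw [Function.update_self, T.lab_zero]
      exact hx₀
    | succ m =>
      have hpar : par (m + 1) < m + 1 := Nat.lt_succ_of_le (T.par_le m)
      have hfin : (Set.Iio m).Finite := Set.finite_Iio m
      have := FiniteDimensional.span_of_finite ℝ (hfin.image (br f))
      have := FiniteDimensional.span_of_finite ℝ (hfin.image (vec f))
      have hwpos : 0 < basisWeight (m + 1) := one_pos.trans_le (one_le_basisWeight _)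
      obtain ⟨z, hz, y, h1, h2, h3, h4, h5, h6⟩ := exists_branch hε (T.lab_lt m) (hprev _ hpar).1
        (Submodule.span ℝ (br f '' Set.Iio m)) (Submodule.span ℝ (vec f '' Set.Iio m))
        (hfin.image (vec f)) (θ := basisWeight m / basisWeight (m + 1))
        (δ := 1 / ((m : ℝ) + 1)) ((div_lt_one hwpos).mpr (basisWeight_lt_succ m)) (by positivity)
      set g := Function.update f (m + 1) (z, y) with hg
      have hgf : ∀ k < m + 1, g k = f k := fun k hk => Function.update_of_ne hk.ne _ _
      have hgm : g (m + 1) = (z, y) := Function.update_self ..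
      have hgb : br g m = z - (f (par (m + 1))).1 := by
        simp only [br, branch]
        rw [hgm, hgf _ hpar]
      have hgv : vec g m = y := by
        simp only [vec]
        rw [hgm]
      have hgb' : ∀ k < m, br g k = br f k := by
        intro k hk
        simp only [br, branch]
        rw [hgf (k + 1) (by omega), hgf (par (k + 1)) ((T.par_le k).trans_lt (by omega))]
      have hgv' : ∀ k < m, vec g k = vec f k := by
        intro k hk
        simp only [vec]
        rw [hgf (k + 1) (by omega)]
      refine ⟨(z, y), by rw [← hg, hgm]; exact hz, ?_⟩
      rintro m' hm'
      obtain rfl : m = m' := by omega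
      rw [← hg]
      refine ⟨by rwa [hgb], by rwa [hgv], by rwa [hgb, hgv], fun k hk => ?_,
        almostOrthogonalAt_of_forall ?_, almostOrthogonalAt_of_forall ?_⟩
      · rw [hgb, hgv' k hk]
        exact h4 _ ⟨k, hk, rfl⟩
      · rw [Set.image_congr (s := Set.Iio m) hgb', hgb]
        exact h5
      · rw [Set.image_congr (s := Set.Iio m) hgv', hgv]
        exact h6)
  have hQ : ∀ m, Q' m f := fun m => (hf (m + 1)).2 m rfl
  refine ⟨fun n => (f n).1, vec f, fun n => ?_, fun m => ?_, fun m => (hQ m).2.1,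
    fun m => (hQ m).2.2.1, fun m => (hQ m).2.2.2.1, fun m => (hQ m).2.2.2.2.1,
    fun m => (hQ m).2.2.2.2.2⟩
  · have := szlenkIter_antitone ε _ (zero_le (a := lab n)) (hf n).1
    rw [szlenkIter_zero] at this
    exact mem_closedBall_zero_iff.mp this
  · have := (hQ m).1
    change ε / 16 ≤ ‖br f m‖
    linarith

end Selection

/-! ### Subspaces with a basis -/

section Subspace

variable {X : Type u} [NormedAddCommGroup X] [NormedSpace ℝ X]

theorem topologicalClosure_span_range_eq_top {u : ℕ → X}
    {e : ℕ → (Submodule.span ℝ (Set.range u)).topologicalClosure} (he : ∀ i, (e i : X) = u i) :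
    (Submodule.span ℝ (Set.range e)).topologicalClosure = ⊤ := by
  refine topologicalClosure_span_eq_top fun f hf => ?_
  obtain ⟨g, hg, -⟩ := exists_extension_norm_eq _ f
  have hle : (Submodule.span ℝ (Set.range u)).topologicalClosure ≤ g.toLinearMap.ker := by
    refine Submodule.topologicalClosure_minimal _ (Submodule.span_le.mpr ?_) g.isClosed_ker
    rintro _ ⟨i, rfl⟩
    change g (u i) = 0
    rw [← he, hg, hf]
  ext v
  rw [← hg v]
  exact hle v.2

theorem nonempty_schauderBasis_closedSpan {u : ℕ → X} (hu : ∀ n, AlmostOrthogonalAt u n)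
    (hu0 : ∀ n, u n ≠ 0) :
    Nonempty (SchauderBasis ℝ (Submodule.span ℝ (Set.range u)).topologicalClosure) := by
  obtain ⟨f, hfu, hC⟩ := exists_biorthogonal hu hu0
  let e : ℕ → (Submodule.span ℝ (Set.range u)).topologicalClosure := fun i =>
    ⟨u i, Submodule.le_topologicalClosure _ (Submodule.subset_span ⟨i, rfl⟩)⟩
  refine nonempty_schauderBasis (u := e) (C := 2)
    (f := fun i => (f i).comp (Submodule.subtypeL _)) (fun i j => hfu i j)
    (topologicalClosure_span_range_eq_top fun i => rfl) fun n v => ?_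
  rw [Submodule.coe_norm, Submodule.coe_norm]
  simpa [e] using hC n v v.2

/-- The closed span of the vectors of a basic tree carries the restricted tree, since the branches
stay large on the basis vectors. -/
theorem IsBasicTree.exists_subspace {α : Ordinal.{u}} {lab : ℕ → Ordinal.{u}} {par : ℕ → ℕ}
    (T : IsOrdinalTree α lab par) {r : ℝ} (hr : 0 < r) {x : ℕ → StrongDual ℝ X} {y : ℕ → X}
    (B : IsBasicTree par r x y) :
    ∃ Y : Submodule ℝ X, IsClosed (Y : Set X) ∧ Nonempty (SchauderBasis ℝ Y) ∧
      (α : WithTop Ordinal.{u}) < szlenkIndex Y := by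
  have hy0 : ∀ n, y n ≠ 0 := fun n h => by
    have := B.le_branch_apply n
    rw [h, map_zero] at this
    linarith
  set Y := (Submodule.span ℝ (Set.range y)).topologicalClosure with hY
  refine ⟨Y, Submodule.isClosed_topologicalClosure _,
    nonempty_schauderBasis_closedSpan B.vec_almostOrthogonal hy0, ?_⟩
  let e : ℕ → Y := fun i =>
    ⟨y i, Submodule.le_topologicalClosure _ (Submodule.subset_span ⟨i, rfl⟩)⟩
  let x' : ℕ → StrongDual ℝ Y := fun n => (x n).comp Y.subtypeL
  have hx'v : ∀ m (v : Y), (x' (m + 1) - x' (par (m + 1))) v = branch par x m v := fun m v => rfl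
  have hx' : ∀ n, ‖x' n‖ ≤ 1 := fun n =>
    ContinuousLinearMap.opNorm_le_bound _ zero_le_one fun v => (x n).le_of_opNorm_le (B.norm_le n) v
  refine lt_szlenkIndex_iff.mpr ⟨r, hr, x' 0, T.mem_szlenkIter hx' (fun m => ?_) ?_ α 0
    T.lab_zero.ge⟩
  · have h1 := (le_abs_self _).trans
      ((x' (m + 1) - x' (par (m + 1))).le_of_opNorm_le le_rfl (e m))
    rw [hx'v] at h1
    have h2 : ‖e m‖ ≤ 1 := B.norm_vec_le m
    have h3 : r ≤ branch par x m (e m) := B.le_branch_apply m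
    nlinarith [norm_nonneg (x' (m + 1) - x' (par (m + 1)))]
  · refine tendsto_zero_of_dense_span (M := 2) (fun m => ?_)
      (topologicalClosure_span_range_eq_top (e := e) fun i => rfl) ?_
    · linarith [norm_sub_le (x' (m + 1)) (x' (par (m + 1))), hx' (m + 1), hx' (par (m + 1))]
    · rintro _ ⟨k, rfl⟩
      refine squeeze_zero_norm' ?_ tendsto_one_div_add_atTop_nhds_zero_nat
      filter_upwards [eventually_gt_atTop k] with m hm
      rw [hx'v]
      exact B.abs_branch_apply_le m k hm

end Subspace

/-! ### Quotients with a basis -/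

section Quotient

variable {X : Type u} [NormedAddCommGroup X] [NormedSpace ℝ X]

theorem exists_dual_quotient (Z : Submodule ℝ X) [IsClosed (Z : Set X)] {w : StrongDual ℝ X}
    (hw : ∀ z ∈ Z, w z = 0) :
    ∃ φ : StrongDual ℝ (X ⧸ Z), (∀ x, φ (Submodule.Quotient.mk x) = w x) ∧ ‖φ‖ ≤ ‖w‖ := by
  refine ⟨(Z.liftQ w.toLinearMap hw).mkContinuous ‖w‖ fun q => ?_, fun x => rfl,
    LinearMap.mkContinuous_norm_le _ (norm_nonneg w) _⟩
  refine le_of_forall_pos_le_add fun δ hδ => ?_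
  obtain ⟨x, rfl, hx⟩ := Submodule.Quotient.norm_mk_lt q
    (show 0 < δ / (‖w‖ + 1) by positivity)
  change ‖w x‖ ≤ _
  have h1 := w.le_opNorm x
  have h2 : ‖w‖ * (δ / (‖w‖ + 1)) ≤ δ := by
    rw [mul_div_assoc', div_le_iff₀ (by positivity)]
    nlinarith
  nlinarith [norm_nonneg w]

theorem norm_comp_mkQL_le (Z : Submodule ℝ X) [IsClosed (Z : Set X)] (φ : StrongDual ℝ (X ⧸ Z)) :
    ‖φ.comp Z.mkQL‖ ≤ ‖φ‖ := by
  refine ContinuousLinearMap.opNorm_le_bound _ (norm_nonneg φ) fun x => ?_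
  refine (φ.le_opNorm _).trans (mul_le_mul_of_nonneg_left ?_ (norm_nonneg φ))
  exact Submodule.Quotient.norm_mk_le Z x

/-- In a reflexive space, a norm-closed span of functionals contains every functional vanishing on
their common kernel. -/
theorem mem_closedSpan_of_forall_eq_zero (hX : IsReflexiveSpace X) {d : ℕ → StrongDual ℝ X}
    {w : StrongDual ℝ X} (hw : ∀ x, (∀ j, d j x = 0) → w x = 0) :
    w ∈ (Submodule.span ℝ (Set.range d)).topologicalClosure := by
  by_contra hnot
  obtain ⟨Φ, hΦw, hΦ⟩ := exists_dual_eq_one_of_notMem (Submodule.isClosed_topologicalClosure _) hnot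
  obtain ⟨x, rfl⟩ := hX Φ
  rw [NormedSpace.dual_def] at hΦw
  rw [hw x fun j => hΦ _ (Submodule.le_topologicalClosure _ (Submodule.subset_span ⟨j, rfl⟩))] at hΦw
  exact zero_ne_one hΦw

/-- Let `d` be an almost orthogonal sequence of nonzero functionals on a reflexive space `X` and `Z`
their common kernel. The dual of `X ⧸ Z` is the closed span of `d`, and the functionals biorthogonal
to `d` are, by reflexivity, evaluations at vectors of `X`, whose classes form a basis of `X ⧸ Z`:
the partial sum operators are the preadjoints of those of `d`. -/
theorem exists_biorthogonal_quotient (hX : IsReflexiveSpace X) {d : ℕ → StrongDual ℝ X}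
    (hd : ∀ n, AlmostOrthogonalAt d n) (hd0 : ∀ n, d n ≠ 0) (Z : Submodule ℝ X)
    [IsClosed (Z : Set X)] (hZ : ∀ x, x ∈ Z ↔ ∀ j, d j x = 0) :
    Nonempty (SchauderBasis ℝ (X ⧸ Z)) ∧ ∃ v : ℕ → X,
      (∀ i j, d i (v j) = if i = j then 1 else 0) ∧
      (Submodule.span ℝ (Set.range fun i => (Submodule.Quotient.mk (v i) : X ⧸ Z))
        ).topologicalClosure = ⊤ := by
  obtain ⟨F, hFd, hC⟩ := exists_biorthogonal hd hd0
  choose v hv using fun i => hX (F i)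
  have hFv : ∀ i (w : StrongDual ℝ X), F i w = w (v i) := fun i w => by
    rw [← hv, NormedSpace.dual_def]
  have hdv : ∀ i j, d i (v j) = if i = j then 1 else 0 := fun i j => by
    rw [← hFv, hFd]
    simp only [eq_comm]
  have hmem : ∀ φ : StrongDual ℝ (X ⧸ Z),
      φ.comp Z.mkQL ∈ (Submodule.span ℝ (Set.range d)).topologicalClosure := fun φ => by
    refine mem_closedSpan_of_forall_eq_zero hX fun x hx => ?_
    change φ (Submodule.Quotient.mk x) = 0
    rw [(Submodule.Quotient.mk_eq_zero Z).mpr ((hZ x).mpr hx), map_zero]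
  have hdense : (Submodule.span ℝ (Set.range fun i => (Submodule.Quotient.mk (v i) : X ⧸ Z))
      ).topologicalClosure = ⊤ := by
    refine topologicalClosure_span_eq_top fun φ hφ => ?_
    have hlim := tendsto_sum_coord hFd hC (hmem φ)
    have hzero : ∀ i, F i (φ.comp Z.mkQL) = 0 := fun i => by
      rw [hFv]
      exact hφ i
    simp only [hzero, zero_smul, Finset.sum_const_zero] at hlim
    have h0 := tendsto_nhds_unique hlim tendsto_const_nhds
    ext q
    obtain ⟨x, rfl⟩ := Submodule.Quotient.mk_surjective Z q
    exact DFunLike.congr_fun h0 x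
  choose g hg hgn using fun i => exists_dual_quotient Z (w := d i) fun z hz => (hZ z).mp hz i
  refine ⟨nonempty_schauderBasis (f := g) (C := 2) (fun i j => ?_) hdense fun n q => ?_, v, hdv,
    hdense⟩
  · rw [hg, hdv]
  · refine NormedSpace.norm_le_dual_bound ℝ _ (by positivity) fun φ => ?_
    refine le_of_forall_pos_le_add fun δ hδ => ?_
    obtain ⟨x, rfl, hx⟩ := Submodule.Quotient.norm_mk_lt q
      (show 0 < δ / (2 * ‖φ‖ + 1) by positivity)
    have h1 : φ (∑ i ∈ Finset.range n,
        g i (Submodule.Quotient.mk x) • (Submodule.Quotient.mk (v i) : X ⧸ Z)) =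
        (∑ i ∈ Finset.range n, F i (φ.comp Z.mkQL) • d i) x := by
      simp only [map_sum, map_smul, hg, hFv, sum_apply, smul_apply, smul_eq_mul]
      exact Finset.sum_congr rfl fun i _ => mul_comm _ _
    rw [h1]
    have h2 := (hC n _ (hmem φ)).trans
      (mul_le_mul_of_nonneg_left (norm_comp_mkQL_le Z φ) zero_le_two)
    have h3 := ContinuousLinearMap.le_of_opNorm_le _ h2 x
    have h4 : 2 * ‖φ‖ * (δ / (2 * ‖φ‖ + 1)) ≤ δ := by
      rw [mul_div_assoc', div_le_iff₀ (by positivity)]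
      nlinarith [norm_nonneg φ]
    nlinarith [norm_nonneg φ]

/-- The quotient by the common kernel of the branches of a basic tree carries the tree, up to a
translation and a factor `1 / 2`. -/
theorem IsBasicTree.exists_quotient (hX : IsReflexiveSpace X) {α : Ordinal.{u}}
    {lab : ℕ → Ordinal.{u}} {par : ℕ → ℕ} (T : IsOrdinalTree α lab par) {r : ℝ} (hr : 0 < r)
    {x : ℕ → StrongDual ℝ X} {y : ℕ → X} (B : IsBasicTree par r x y) :
    ∃ (Z : Submodule ℝ X) (_ : IsClosed (Z : Set X)), Nonempty (SchauderBasis ℝ (X ⧸ Z)) ∧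
      (α : WithTop Ordinal.{u}) < szlenkIndex (X ⧸ Z) := by
  let Z : Submodule ℝ X := ⨅ j, (branch par x j).toLinearMap.ker
  have hZ : ∀ v, v ∈ Z ↔ ∀ j, branch par x j v = 0 := fun v => Submodule.mem_iInf _
  have hZc : IsClosed (Z : Set X) := by
    rw [Submodule.coe_iInf]
    exact isClosed_iInter fun j => (branch par x j).isClosed_ker
  have hb0 : ∀ n, branch par x n ≠ 0 := fun n h => by
    have := B.le_norm_branch n
    rw [h, norm_zero] at this
    linarith
  obtain ⟨hbasis, v, hdv, hdense⟩ :=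
    exists_biorthogonal_quotient hX B.branch_almostOrthogonal hb0 Z hZ
  refine ⟨Z, hZc, hbasis, ?_⟩
  -- The root need not vanish on `Z`, so the tree is first translated to have root `0`.
  have hvanish : ∀ n, ∀ z ∈ Z, ((1 / 2 : ℝ) • (x n - x 0)) z = 0 := by
    intro n z hz
    have key : x n z = x 0 z := by
      induction n using Nat.strong_induction_on with
      | _ n ih =>
        cases n with
        | zero => rfl
        | succ m =>
          have h1 : x (m + 1) z - x (par (m + 1)) z = 0 := (hZ z).mp hz m
          rw [← ih _ (Nat.lt_succ_of_le (T.par_le m))]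
          linarith
    simp [key]
  choose φ hφ hφn using fun n => exists_dual_quotient Z (hvanish n)
  have hφ1 : ∀ n, ‖φ n‖ ≤ 1 := fun n => by
    refine (hφn n).trans ?_
    rw [norm_smul, Real.norm_eq_abs, abs_of_pos (by norm_num)]
    linarith [norm_sub_le (x n) (x 0), B.norm_le n, B.norm_le 0]
  have hbr : ∀ m q, (φ (m + 1) - φ (par (m + 1))) (Submodule.Quotient.mk q) =
      1 / 2 * branch par x m q := fun m q => by
    rw [sub_apply, hφ, hφ]
    simp only [branch, smul_apply, sub_apply, smul_eq_mul]
    ring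
  refine lt_szlenkIndex_iff.mpr ⟨r / 2, by positivity, φ 0, T.mem_szlenkIter hφ1 (fun m => ?_) ?_
    α 0 T.lab_zero.ge⟩
  · have h1 : (φ (m + 1) - φ (par (m + 1))).comp Z.mkQL = (1 / 2 : ℝ) • branch par x m := by
      ext q
      exact hbr m q
    have h2 := norm_comp_mkQL_le Z (φ (m + 1) - φ (par (m + 1)))
    rw [h1, norm_smul, Real.norm_eq_abs, abs_of_pos (by norm_num)] at h2
    linarith [B.le_norm_branch m]
  · refine tendsto_zero_of_dense_span (M := 2) (fun m => ?_) hdense ?_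
    · linarith [norm_sub_le (φ (m + 1)) (φ (par (m + 1))), hφ1 (m + 1), hφ1 (par (m + 1))]
    · rintro _ ⟨k, rfl⟩
      refine tendsto_const_nhds.congr' ?_
      filter_upwards [eventually_gt_atTop k] with m hm
      rw [hbr, hdv, if_neg hm.ne', mul_zero]

end Quotient

/-! ### Subspaces and quotients with prescribed Szlenk index -/

/-- Subspace and quotient with infinite bases for a nonzero countable ordinal. -/
theorem exists_subspace_and_quotient {X : Type u} [NormedAddCommGroup X] [NormedSpace ℝ X]
    (hX : IsReflexiveSpace X) {α : Ordinal.{u}} (hα : α < ω₁) (hα0 : α ≠ 0)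
    (hSz : (α : WithTop Ordinal.{u}) < szlenkIndex X) :
    (∃ Y : Submodule ℝ X, IsClosed (Y : Set X) ∧ Nonempty (SchauderBasis ℝ Y) ∧
        (α : WithTop Ordinal.{u}) < szlenkIndex Y) ∧
    (∃ (Z : Submodule ℝ X) (_ : IsClosed (Z : Set X)), Nonempty (SchauderBasis ℝ (X ⧸ Z)) ∧
        (α : WithTop Ordinal.{u}) < szlenkIndex (X ⧸ Z)) := by
  obtain ⟨ε, hε, hne⟩ := lt_szlenkIndex_iff.mp hSz
  obtain ⟨lab, par, T⟩ := exists_isOrdinalTree hα hα0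
  obtain ⟨x, y, B⟩ := T.exists_isBasicTree hε hne
  exact ⟨B.exists_subspace T (by positivity), B.exists_quotient hX T (by positivity)⟩

theorem zero_lt_szlenkIndex (X : Type u) [NormedAddCommGroup X] [NormedSpace ℝ X] :
    ((0 : Ordinal.{u}) : WithTop Ordinal.{u}) < szlenkIndex X :=
  lt_szlenkIndex_iff.mpr ⟨1, one_pos, 0, by
    rw [szlenkIter_zero]
    exact Metric.mem_closedBall_self zero_le_one⟩

theorem hasBasis_of_subsingleton (X : Type u) [NormedAddCommGroup X] [NormedSpace ℝ X]
    [Subsingleton X] : HasBasis X :=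
  Or.inr ⟨0, ⟨Module.Basis.empty X⟩⟩

theorem mainTheorem3 (X : Type u) [NormedAddCommGroup X] [NormedSpace ℝ X] [CompleteSpace X]
    (hX : IsReflexiveSpace X) (α : Ordinal.{u}) (hα : α < ω₁)
    (hSz : (α : WithTop Ordinal.{u}) < szlenkIndex X) :
    (∃ Y : Submodule ℝ X, IsClosed (Y : Set X) ∧ HasBasis Y ∧
        (α : WithTop Ordinal.{u}) < szlenkIndex Y ∧
        (¬ FiniteDimensional ℝ X → ¬ FiniteDimensional ℝ Y)) ∧
    (∃ (Z : Submodule ℝ X) (_ : IsClosed (Z : Set X)), HasBasis (X ⧸ Z) ∧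
        (α : WithTop Ordinal.{u}) < szlenkIndex (X ⧸ Z) ∧
        (¬ FiniteDimensional ℝ X → ¬ FiniteDimensional ℝ (X ⧸ Z))) := by
  by_cases hcase : α = 0 ∧ FiniteDimensional ℝ X
  · obtain ⟨rfl, hfd⟩ := hcase
    have hcl : IsClosed ((⊤ : Submodule ℝ X) : Set X) := isClosed_univ
    exact ⟨⟨⊥, isClosed_singleton, hasBasis_of_subsingleton _, zero_lt_szlenkIndex _,
        fun h => absurd hfd h⟩,
      ⟨⊤, hcl, hasBasis_of_subsingleton _, zero_lt_szlenkIndex _, fun h => absurd hfd h⟩⟩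
  -- In infinite dimensions the index exceeds `1`, so `α` may be assumed nonzero.
  · obtain ⟨β, hαβ, hβ, hβ0, hβSz⟩ : ∃ β : Ordinal.{u}, α ≤ β ∧ β < ω₁ ∧ β ≠ 0 ∧
        (β : WithTop Ordinal.{u}) < szlenkIndex X := by
      rcases eq_or_ne α 0 with rfl | h
      · exact ⟨1, zero_le_one, Ordinal.one_lt_omega0.trans Ordinal.omega0_lt_omega_one, one_ne_zero,
          one_lt_szlenkIndex fun h => hcase ⟨rfl, h⟩⟩
      · exact ⟨α, le_rfl, hα, h, hSz⟩
    have hle : (α : WithTop Ordinal.{u}) ≤ β := WithTop.coe_le_coe.mpr hαβ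
    obtain ⟨⟨Y, hY, ⟨b⟩, hYSz⟩, ⟨Z, hZ, ⟨c⟩, hZSz⟩⟩ := exists_subspace_and_quotient hX hβ hβ0 hβSz
    exact ⟨⟨Y, hY, Or.inl ⟨b⟩, hle.trans_lt hYSz, fun _ => b.not_finiteDimensional⟩,
      ⟨Z, hZ, Or.inl ⟨c⟩, hle.trans_lt hZSz, fun _ => c.not_finiteDimensional⟩⟩
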